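/- Let $d\ge 1$ and let $E^d$ be the $d$-dimensional Euclidean space. A gliding arrangement $\mathcal A$ in $E^d$ is a finite family of (not necessarily distinct) hyperplanes $H_1,\dots,H_m$, each with a unit normal vector $N_j$ and a constant velocity vector $v_j$ parallel to $N_j$; put $H_j(t)=H_j+tv_j$ for $t\in\mathbb R$. For a sign vector $\varepsilon\in\{\pm1\}^m$, the cell of $\mathcal A$ at time $t$ is $$C_\varepsilon(t)=\{Q\in E^d : \varepsilon_j\, d(Q,H_j(t))\ge 0 \text{ for all } j\},$$ where $d(Q,H_j(t))=\langle Q-Q_0,N_j\rangle$ for any $Q_0\in H_j(t)$ is the signed distance. The arrangement is of first type if for some $\varepsilon$ and $t_0$ the cell $C_\varepsilon(t_0)$ is bounded and has nonzero $d$-dimensional volume. It has absolute rank $k$ if any $k$ members of the family $N_1,\dots,N_m$ are linearly independent and some $k+1$ members are linearly dependent. **Theorem.** Let $\mathcal A$ be a gliding arrangement in $E^d$ of first type and of absolute rank $k$, and let $C=C_\varepsilon$ be a cell such that for some $t_0$ the set $C(t_0)$ is bounded and has nonzero $d$-dimensional volume. Then $C(t)$ is bounded for every $t\in\mathbb R$,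 and the function $W(t)=\mathrm{vol}_d(C(t))$ is a pluriphase Steiner-like function of degree $d$ on $\mathbb R$, that is, it is nonnegative and continuous and there are finitely many points $g_1<\dots<g_n$ such that on each of the intervals $(-\infty,g_1],[g_1,g_2],\dots,[g_n,\infty)$ it coincides with a polynomial of degree at most $d$. Moreover $W$ is of class $\mathcal C^{k-1}$ on $\mathbb R$. -/

import Mathlib

/-- An oriented hyperplane of the Euclidean space of dimension `d`, given by one of its points
and by the unit normal vector that orients it. -/
structure OrientedHyperplane (d : ℕ) where
  point : EuclideanSpace ℝ (Fin d)
  normal : EuclideanSpace ℝ (Fin d)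
  norm_normal : ‖normal‖ = 1

namespace OrientedHyperplane

variable {d : ℕ}

/-- The underlying set of points of the hyperplane. -/
def carrier (H : OrientedHyperplane d) : Set (EuclideanSpace ℝ (Fin d)) :=
  {Q | inner ℝ (Q - H.point) H.normal = 0}

/-- The signed distance from the point `Q` to the oriented hyperplane `H`. -/
noncomputable def signedDist (H : OrientedHyperplane d) (Q : EuclideanSpace ℝ (Fin d)) : ℝ :=
  inner ℝ (Q - H.point) H.normal

/-- The signed distance may be computed from any point of the hyperplane. -/
theorem signedDist_eq_of_mem (H : OrientedHyperplane d) {Q₀ : EuclideanSpace ℝ (Fin d)}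
    (h : Q₀ ∈ H.carrier) (Q : EuclideanSpace ℝ (Fin d)) :
    H.signedDist Q = inner ℝ (Q - Q₀) H.normal := by
  have h' : inner ℝ (Q₀ - H.point) H.normal = 0 := h
  have e : Q - H.point = (Q - Q₀) + (Q₀ - H.point) := by abel
  rw [signedDist, e, inner_add_left, h', add_zero]

end OrientedHyperplane

/-- The cell with sign vector `ε` of a finite family of oriented hyperplanes
(not necessarily distinct). The type `ℤˣ` is `{1, -1}`. -/
def arrangementCell {d m : ℕ} (H : Fin m → OrientedHyperplane d) (ε : Fin m → ℤˣ) :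
    Set (EuclideanSpace ℝ (Fin d)) :=
  {Q | ∀ j, 0 ≤ ((ε j : ℤ) : ℝ) * (H j).signedDist Q}

/-- A finite family of vectors has absolute rank `k` if any `k` of its members are linearly
independent while some `k + 1` of its members are linearly dependent (members are
counted with their indices); by convention, the empty family has absolute rank `0`. -/
def HasAbsoluteRank {d m : ℕ} (N : Fin m → EuclideanSpace ℝ (Fin d)) (k : ℕ) : Prop :=
  (∀ s : Finset (Fin m), s.card = k → LinearIndependent ℝ (fun i : s => N i)) ∧
    ((∃ s : Finset (Fin m), s.card = k + 1 ∧ ¬ LinearIndependent ℝ (fun i : s => N i)) ∨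
      (m = 0 ∧ k = 0))

/-- An oriented hyperplane with a velocity vector normal to it. -/
structure GlidingHyperplane (d : ℕ) extends OrientedHyperplane d where
  velocity : EuclideanSpace ℝ (Fin d)
  velocity_mem : velocity ∈ Submodule.span ℝ {normal}

/-- The position at time `t`: the translate by `t` times the velocity, with the same normal. -/
noncomputable def GlidingHyperplane.atTime {d : ℕ} (H : GlidingHyperplane d) (t : ℝ) :
    OrientedHyperplane d where
  point := H.point + t • H.velocity
  normal := H.normal
  norm_normal := H.norm_normal

/-- A gliding arrangement: a finite family of gliding hyperplanes. -/
abbrev GlidingArrangement (d m : ℕ) : Type := Fin m → GlidingHyperplane d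

namespace GlidingArrangement

variable {d m : ℕ}

/-- The cell with sign vector `ε` of the arrangement at time `t`. -/
def cell (A : GlidingArrangement d m) (ε : Fin m → ℤˣ) (t : ℝ) :
    Set (EuclideanSpace ℝ (Fin d)) :=
  arrangementCell (fun j => (A j).atTime t) ε

/-- The `d`-dimensional volume of the cell with sign vector `ε`, as a function of time. -/
noncomputable def cellVolume (A : GlidingArrangement d m) (ε : Fin m → ℤˣ) (t : ℝ) : ℝ :=
  (MeasureTheory.volume (A.cell ε t)).toReal

/-- The arrangement has, at some time, a bounded cell of nonzero volume. -/
def IsFirstType (A : GlidingArrangement d m) : Prop :=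
  ∃ (ε : Fin m → ℤˣ) (t₀ : ℝ), Bornology.IsBounded (A.cell ε t₀) ∧
    MeasureTheory.volume (A.cell ε t₀) ≠ 0

/-- The absolute rank of the family of normal vectors, which does not change in time. -/
def HasAbsoluteRank (A : GlidingArrangement d m) (k : ℕ) : Prop :=
  _root_.HasAbsoluteRank (fun j => (A j).normal) k

end GlidingArrangement

/-- A pluriphase Steiner-like function of degree `d` on the real line: a nonnegative continuous
function for which there are break points `g 0 < ⋯ < g (n - 1)` such that on each of the `n + 1`
closed intervals `(-∞, g 0]`, `[g 0, g 1]`, …, `[g (n - 1), ∞)` that they delimit it is given by a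
polynomial `∑ κ_r t ^ r`, `r ≤ d`. -/
structure IsPluriphaseSteinerLike (d : ℕ) (φ : ℝ → ℝ) : Prop where
  nonneg : ∀ t, 0 ≤ φ t
  continuous : Continuous φ
  piecewise : ∃ (n : ℕ) (g : Fin n → ℝ) (p : Fin (n + 1) → Polynomial ℝ),
    StrictMono g ∧ (∀ i, (p i).natDegree ≤ d) ∧
      ∀ (i : Fin (n + 1)) (t : ℝ),
        (∀ j : Fin n, j.castSucc < i → g j ≤ t) → (∀ j : Fin n, i ≤ j.castSucc → t ≤ g j) →
          φ t = (p i).eval t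

open Filter Topology Set Polynomial MeasureTheory

universe u v

/-! A cell is a polyhedron `b i ≤ ℓ i x` with fixed functionals and bounds affine in time, so
everything concerns the volume `V(b)`. Being nonempty and bounded at one time forces
`TrivialRecession`, a condition free of `b`; compactness of the sphere then bounds all the
polyhedra, uniformly for bounded `b`.

By Fubini along `ℓ j`, the partial derivative of `V` in `b j` is minus the volume of the facet `ℓ j
x = b j` (`exists_facet_hasDerivAt`). The facet is a polyhedron of the same kind in `ker (ℓ j)`,
with bounds linear in `b`, which permits two inductions. Restriction to the kernel costs one unit of
independence, so `V` is `C^(k-1)` when any `k ≥ 1` functionals are independent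
(`contDiff_measure_polyhedron`). It also costs one dimension: along the motion, off finitely many
times, the derivative of the volume is a constant combination of facet volumes, hence piecewise
polynomial of lower degree (`isPiecewisePolynomial_measure_polyhedron`). Continuity extends the
polynomial formulas to the break points. -/

/-! ### Differentiability from partial derivatives -/

theorem hasFDerivAt_of_continuousAt_partials {ι : Type*} [Fintype ι] [DecidableEq ι]
    {f : (ι → ℝ) → ℝ} {g : ι → (ι → ℝ) → ℝ} {b : ι → ℝ}
    (hf : ∀ j, ∀ᶠ x in 𝓝 b, HasDerivAt (fun u => f (Function.update x j u)) (g j x) (x j))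
    (hg : ∀ j, ContinuousAt (g j) b) :
    HasFDerivAt f (∑ j, g j b • ContinuousLinearMap.proj (R := ℝ) (φ := fun _ : ι => ℝ) j) b := by
  -- Move from `b` to `y` one coordinate at a time, `s` being the coordinates already moved; the
  -- mean value inequality controls each move.
  have key : ∀ s : Finset ι, (fun y => f (s.piecewise y b) - f b - ∑ j ∈ s, g j b * (y j - b j))
      =o[𝓝 b] (fun y => y - b) := by
    intro s
    induction s using Finset.induction_on with
    | empty => simp
    | insert j s hj ih =>
      have step : (fun y => f ((insert j s).piecewise y b) - f (s.piecewise y b)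
          - g j b * (y j - b j)) =o[𝓝 b] (fun y => y - b) := by
        rw [Asymptotics.isLittleO_iff]
        intro ε hε
        have h1 : ∀ᶠ x in 𝓝 b, ‖g j x - g j b‖ ≤ ε := by
          have := (hg j).eventually (Metric.closedBall_mem_nhds (g j b) hε)
          simpa [dist_eq_norm] using this
        obtain ⟨δ, hδ, hb⟩ := Metric.eventually_nhds_iff.1 ((hf j).and h1)
        filter_upwards [Metric.ball_mem_nhds b hδ] with y hy
        set X := s.piecewise y b with hX
        have hin : ∀ u ∈ uIcc (b j) (y j), dist (Function.update X j u) b < δ := by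
          intro u hu
          rw [dist_pi_lt_iff hδ]
          intro i
          have hyi : dist (y i) (b i) < δ := (dist_le_pi_dist y b i).trans_lt hy
          by_cases hij : i = j
          · subst hij
            rw [Function.update_self]
            refine lt_of_le_of_lt ?_ hyi
            rw [Real.dist_eq, Real.dist_eq]
            exact abs_sub_left_of_mem_uIcc hu
          · rw [Function.update_of_ne hij]
            by_cases his : i ∈ s
            · simpa [hX, his] using hyi
            · simpa [hX, his] using hδ
        have hd : ∀ u ∈ uIcc (b j) (y j),
            HasDerivWithinAt (fun u => f (Function.update X j u) - g j b * u)
              (g j (Function.update X j u) - g j b) (uIcc (b j) (y j)) u := by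
          intro u hu
          have h := (hb (hin u hu)).1
          simp only [Function.update_idem, Function.update_self] at h
          have h2 : HasDerivAt (fun u => g j b * u) (g j b) u := by
            simpa using hasDerivAt_const_mul (x := u) (g j b)
          exact (h.sub h2).hasDerivWithinAt
        have hmv := Convex.norm_image_sub_le_of_norm_hasDerivWithin_le hd
          (fun u hu => (hb (hin u hu)).2) (convex_uIcc _ _) left_mem_uIcc right_mem_uIcc
        have hX1 : (insert j s).piecewise y b = Function.update X j (y j) :=
          Finset.piecewise_insert _ _ _ _
        have hX2 : Function.update X j (b j) = X := by
          rw [Function.update_eq_self_iff]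
          simp [hX, hj]
        rw [hX1]
        simp only [hX2] at hmv
        calc _ = ‖f (Function.update X j (y j)) - g j b * y j - (f X - g j b * b j)‖ := by
              congr 1; ring
          _ ≤ ε * ‖y j - b j‖ := hmv
          _ ≤ ε * ‖y - b‖ := by
              gcongr
              exact norm_le_pi_norm (y - b) j
      refine (ih.add step).congr_left fun y => ?_
      rw [Finset.sum_insert hj]
      ring
  rw [hasFDerivAt_iff_isLittleO]
  refine (key Finset.univ).congr_left fun y => ?_
  simp [Finset.piecewise_univ]

/-! ### Piecewise polynomial functions of one variable -/

/-- A function on the line that, away from a finite set, is given on each interval by a polynomial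
of degree at most `n`. -/
def IsPiecewisePolynomial (n : ℕ) (f : ℝ → ℝ) : Prop :=
  ∃ S : Finset ℝ, ∀ I : Set ℝ, I.OrdConnected → Disjoint I (S : Set ℝ) →
    ∃ p : ℝ[X], p.natDegree ≤ n ∧ ∀ t ∈ I, f t = p.eval t

namespace IsPiecewisePolynomial

variable {n : ℕ} {f g : ℝ → ℝ}

theorem const (n : ℕ) (c : ℝ) : IsPiecewisePolynomial n fun _ => c :=
  ⟨∅, fun _ _ _ => ⟨C c, by simp, by simp⟩⟩

theorem add (hf : IsPiecewisePolynomial n f) (hg : IsPiecewisePolynomial n g) :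
    IsPiecewisePolynomial n fun t => f t + g t := by
  classical
  obtain ⟨S, hS⟩ := hf
  obtain ⟨T, hT⟩ := hg
  refine ⟨S ∪ T, fun I hI hd => ?_⟩
  rw [Finset.coe_union, disjoint_union_right] at hd
  obtain ⟨p, hp, hp'⟩ := hS I hI hd.1
  obtain ⟨q, hq, hq'⟩ := hT I hI hd.2
  exact ⟨p + q, natDegree_add_le_of_degree_le hp hq, fun t ht => by
    beta_reduce
    rw [hp' t ht, hq' t ht, eval_add]⟩

theorem const_mul (c : ℝ) (hf : IsPiecewisePolynomial n f) :
    IsPiecewisePolynomial n fun t => c * f t := by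
  obtain ⟨S, hS⟩ := hf
  refine ⟨S, fun I hI hd => ?_⟩
  obtain ⟨p, hp, hp'⟩ := hS I hI hd
  exact ⟨C c * p, (natDegree_C_mul_le c p).trans hp, fun t ht => by
    beta_reduce
    rw [hp' t ht, eval_mul, eval_C]⟩

theorem sum {ι : Type*} (s : Finset ι) {f : ι → ℝ → ℝ}
    (hf : ∀ i ∈ s, IsPiecewisePolynomial n (f i)) :
    IsPiecewisePolynomial n fun t => ∑ i ∈ s, f i t := by
  classical
  induction s using Finset.induction_on with
  | empty => simpa using const n 0
  | insert j s hj ih =>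
    simp only [Finset.sum_insert hj]
    exact (hf j (by simp)).add (ih fun i hi => hf i (by simp [hi]))

theorem ite_affine (hf : IsPiecewisePolynomial n f) (hg : IsPiecewisePolynomial n g) (α β : ℝ) :
    IsPiecewisePolynomial n fun t => if 0 ≤ α + t * β then f t else g t := by
  classical
  obtain ⟨S, hS⟩ := hf
  obtain ⟨T, hT⟩ := hg
  -- A sign change inside an interval forces a zero there, which can only be `-α / β`. If `β = 0`
  -- this adds a harmless break point.
  refine ⟨S ∪ T ∪ {-α / β}, fun I hI hd => ?_⟩
  rw [Finset.coe_union, Finset.coe_union, disjoint_union_right, disjoint_union_right] at hd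
  obtain ⟨p, hp, hp'⟩ := hS I hI hd.1.1
  obtain ⟨q, hq, hq'⟩ := hT I hI hd.1.2
  by_cases hpos : ∀ t ∈ I, 0 ≤ α + t * β
  · exact ⟨p, hp, fun t ht => by beta_reduce; rw [if_pos (hpos t ht), hp' t ht]⟩
  refine ⟨q, hq, fun t ht => ?_⟩
  beta_reduce
  rw [if_neg, hq' t ht]
  intro h0
  push Not at hpos
  obtain ⟨u, hu, hu0⟩ := hpos
  have hβ : β ≠ 0 := by rintro rfl; simp at h0 hu0; linarith
  have hc : ContinuousOn (fun t => α + t * β) (uIcc u t) := by fun_prop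
  obtain ⟨r, hr, hr0⟩ := intermediate_value_uIcc hc
    (show (0 : ℝ) ∈ uIcc (α + u * β) (α + t * β) from mem_uIcc_of_le hu0.le h0)
  have hrI : r ∈ I := hI.uIcc_subset hu ht hr
  refine disjoint_left.1 hd.2 hrI ?_
  simp only [Finset.coe_singleton, mem_singleton_iff]
  field_simp
  simp only at hr0
  linarith

/-- On an interval avoiding both exceptional sets, `f` minus a polynomial antiderivative has zero
derivative, hence is constant. -/
theorem of_hasDerivAt {f' : ℝ → ℝ} (S : Finset ℝ) (hf : ∀ t ∉ S, HasDerivAt f (f' t) t)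
    (hf' : IsPiecewisePolynomial n f') : IsPiecewisePolynomial (n + 1) f := by
  classical
  obtain ⟨T, hT⟩ := hf'
  refine ⟨S ∪ T, fun I hI hd => ?_⟩
  rw [Finset.coe_union, disjoint_union_right] at hd
  obtain ⟨p, hp, hp'⟩ := hT I hI hd.2
  obtain ⟨q, hq, hq'⟩ : ∃ q : ℝ[X], q.natDegree ≤ n + 1 ∧ derivative q = p := by
    refine ⟨∑ i ∈ Finset.range (n + 1), monomial (i + 1) (p.coeff i / (i + 1)), ?_, ?_⟩
    · refine natDegree_sum_le_of_forall_le _ _ fun i hi => ?_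
      exact (natDegree_monomial_le _).trans (by simpa using hi)
    · conv_rhs => rw [p.as_sum_range' (n + 1) (by omega)]
      rw [derivative_sum]
      refine Finset.sum_congr rfl fun i _ => ?_
      rw [derivative_monomial]
      push_cast
      rw [div_mul_cancel₀ _ (by positivity)]
  rcases I.eq_empty_or_nonempty with rfl | ⟨a, ha⟩
  · exact ⟨0, by simp, by simp⟩
  refine ⟨q + C (f a - q.eval a), ?_, fun t ht => ?_⟩
  · exact natDegree_add_le_of_degree_le hq (by simp)
  have hder : ∀ u ∈ I, HasDerivWithinAt (fun u => f u - q.eval u) 0 I u := by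
    intro u hu
    have h := ((hf u fun h => disjoint_left.1 hd.1 hu h).sub (q.hasDerivAt u)).hasDerivWithinAt
      (s := I)
    rwa [hp' u hu, hq', sub_self] at h
  have := Convex.norm_image_sub_le_of_norm_hasDerivWithin_le (C := 0) hder (by simp)
    hI.convex ha ht
  rw [zero_mul, norm_le_zero_iff] at this
  simp only [eval_add, eval_C]
  linarith

theorem isPluriphaseSteinerLike (hf : IsPiecewisePolynomial n f) (hc : Continuous f)
    (h0 : ∀ t, 0 ≤ f t) : IsPluriphaseSteinerLike n f := by
  refine ⟨h0, hc, ?_⟩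
  obtain ⟨S, hS⟩ := hf
  obtain ⟨g, hg⟩ : ∃ g : Fin S.card → ℝ, g = S.orderEmbOfFin rfl := ⟨_, rfl⟩
  have hgm : StrictMono g := hg ▸ (S.orderEmbOfFin rfl).strictMono
  have hgS : ∀ x ∈ S, ∃ j, g j = x := by
    intro x hx
    have : x ∈ Set.range (S.orderEmbOfFin rfl) := by
      rw [Finset.range_orderEmbOfFin]; exact hx
    rwa [← hg] at this
  let I : Fin (S.card + 1) → Set ℝ := fun i =>
    {t | (∀ j : Fin S.card, j.castSucc < i → g j < t) ∧
      ∀ j : Fin S.card, i ≤ j.castSucc → t < g j}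
  have hI : ∀ i, (I i).OrdConnected := fun i => ⟨fun x hx y hy z hz =>
    ⟨fun j hj => (hx.1 j hj).trans_le hz.1, fun j hj => hz.2.trans_lt (hy.2 j hj)⟩⟩
  have hd : ∀ i, Disjoint (I i) (S : Set ℝ) := by
    intro i
    rw [disjoint_left]
    rintro x hx hxS
    obtain ⟨j, rfl⟩ := hgS x hxS
    rcases lt_or_ge j.castSucc i with h | h
    · exact lt_irrefl _ (hx.1 j h)
    · exact lt_irrefl _ (hx.2 j h)
  choose p hp hp' using fun i => hS (I i) (hI i) (hd i)
  refine ⟨S.card, g, p, hgm, hp, fun i t h1 h2 => ?_⟩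
  -- A point `u` of the open piece, possibly unbounded: `t` is the limit of points of that piece on
  -- the segment towards `u`.
  obtain ⟨u, hu1, hu2⟩ := Order.exists_between_finsets
    ((Finset.univ.filter fun j : Fin S.card => j.castSucc < i).image g)
    ((Finset.univ.filter fun j : Fin S.card => i ≤ j.castSucc).image g) (by
      intro x hx y hy
      simp only [Finset.mem_image, Finset.mem_filter, Finset.mem_univ, true_and] at hx hy
      obtain ⟨j, hj, rfl⟩ := hx
      obtain ⟨l, hl, rfl⟩ := hy
      exact hgm (by simpa using hj.trans_le hl))
  simp only [Finset.mem_image, Finset.mem_filter, Finset.mem_univ, true_and,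
    forall_exists_index, and_imp, forall_apply_eq_imp_iff₂] at hu1 hu2
  have hmem : ∀ r ∈ Ioc (0 : ℝ) 1, t + r * (u - t) ∈ I i := by
    intro r hr
    refine ⟨fun j hj => ?_, fun j hj => ?_⟩
    · nlinarith [h1 j hj, hu1 j hj, hr.1, hr.2, mul_pos hr.1 (sub_pos.2 (hu1 j hj)),
        mul_nonneg (sub_nonneg.2 hr.2) (sub_nonneg.2 (h1 j hj))]
    · nlinarith [h2 j hj, hu2 j hj, hr.1, hr.2, mul_pos hr.1 (sub_pos.2 (hu2 j hj)),
        mul_nonneg (sub_nonneg.2 hr.2) (sub_nonneg.2 (h2 j hj))]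
  have hlim : Tendsto (fun r : ℝ => t + r * (u - t)) (𝓝[>] 0) (𝓝 t) := by
    have : Tendsto (fun r : ℝ => t + r * (u - t)) (𝓝 0) (𝓝 (t + 0 * (u - t))) :=
      (by fun_prop : Continuous fun r : ℝ => t + r * (u - t)).tendsto 0
    rw [zero_mul, add_zero] at this
    exact this.mono_left nhdsWithin_le_nhds
  refine tendsto_nhds_unique ((hc.tendsto t).comp hlim)
    ((((p i).continuous.tendsto t).comp hlim).congr' ?_)
  filter_upwards [Ioc_mem_nhdsGT (zero_lt_one' ℝ)] with r hr
  exact (hp' i _ (hmem r hr)).symm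

end IsPiecewisePolynomial

/-! ### Polyhedra, recession cones and facets -/

/-- The polyhedron cut out by the inequalities `b i ≤ ℓ i x`. -/
def polyhedron {E : Type u} [NormedAddCommGroup E] [NormedSpace ℝ E] {ι : Type v}
    (ℓ : ι → E →L[ℝ] ℝ) (b : ι → ℝ) : Set E :=
  {x | ∀ i, b i ≤ ℓ i x}

/-- No nonzero vector is nonnegative on all the functionals: the polyhedra they define have trivial
recession cone. -/
def TrivialRecession {E : Type u} [NormedAddCommGroup E] [NormedSpace ℝ E] {ι : Type v}
    (ℓ : ι → E →L[ℝ] ℝ) : Prop :=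
  ∀ x, (∀ i, 0 ≤ ℓ i x) → x = 0

/-- The restrictions of the remaining functionals to the kernel of `ℓ j`. -/
def facetFunctionals {E : Type u} [NormedAddCommGroup E] [NormedSpace ℝ E] {ι : Type v}
    (ℓ : ι → E →L[ℝ] ℝ) (j : ι) :
    {i // i ≠ j} → LinearMap.ker (ℓ j).toLinearMap →L[ℝ] ℝ :=
  fun i => (ℓ i).comp (Submodule.subtypeL _)

/-- The bounds that describe the facet `ℓ j x = b j`, seen from its point `b j • e`. -/
def facetBounds {E : Type u} [NormedAddCommGroup E] [NormedSpace ℝ E] {ι : Type v}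
    (ℓ : ι → E →L[ℝ] ℝ) (j : ι) (e : E) (b : ι → ℝ) : {i // i ≠ j} → ℝ :=
  fun i => b i - b j * ℓ i e

section

variable {E : Type u} [NormedAddCommGroup E] [NormedSpace ℝ E]
  {ι : Type v} {ℓ : ι → E →L[ℝ] ℝ}

theorem isClosed_polyhedron (ℓ : ι → E →L[ℝ] ℝ) (b : ι → ℝ) : IsClosed (polyhedron ℓ b) := by
  simp only [polyhedron, ofPred_forall]
  exact isClosed_iInter fun i => isClosed_le continuous_const (ℓ i).continuous

theorem TrivialRecession.of_isBounded {b : ι → ℝ} (hb : Bornology.IsBounded (polyhedron ℓ b))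
    (hne : (polyhedron ℓ b).Nonempty) : TrivialRecession ℓ := by
  intro y hy
  obtain ⟨x, hx⟩ := hne
  obtain ⟨R, hR⟩ := hb.exists_norm_le
  by_contra hy0
  have hy0' : 0 < ‖y‖ := norm_pos_iff.2 hy0
  have hR0 : 0 ≤ R := (norm_nonneg _).trans (hR x hx)
  -- Gives `‖r • y‖ = 2 * R + 1`, too long for two points of norm at most `R`.
  set r := (2 * R + 1) / ‖y‖ with hr
  have hr0 : 0 ≤ r := by positivity
  have hmem : x + r • y ∈ polyhedron ℓ b := by
    intro i
    rw [map_add, map_smul, smul_eq_mul]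
    exact (hx i).trans (le_add_of_nonneg_right (mul_nonneg hr0 (hy i)))
  have h1 : ‖r • y‖ ≤ ‖x + r • y‖ + ‖x‖ := by
    simpa using norm_sub_le (x + r • y) x
  rw [norm_smul, Real.norm_of_nonneg hr0, hr, div_mul_cancel₀ _ hy0'.ne'] at h1
  linarith [hR _ hmem, hR x hx]

/-- At each unit vector some functional is negative, uniformly so by compactness; then scale. The
alternative `x = 0` matters only for an empty family, where `M` may be negative. -/
theorem TrivialRecession.exists_norm_le [FiniteDimensional ℝ E] (hℓ : TrivialRecession ℓ) :
    ∃ C : ℝ, 0 ≤ C ∧ ∀ x M, (∀ i, -M ≤ ℓ i x) → ‖x‖ ≤ C * M ∨ x = 0 := by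
  obtain ⟨N, hN⟩ := (isCompact_sphere (0 : E) 1).elim_directed_cover
    (fun n : ℕ => ⋃ i, {x : E | ℓ i x < -(1 / ((n : ℝ) + 1))})
    (fun n => isOpen_iUnion fun i => isOpen_lt (ℓ i).continuous continuous_const)
    (by
      intro x hx
      have hx0 : x ≠ 0 := by
        rintro rfl
        simp at hx
      have : ∃ i, ℓ i x < 0 := by
        by_contra! h
        exact hx0 (hℓ x h)
      obtain ⟨i, hi⟩ := this
      obtain ⟨n, hn⟩ := exists_nat_one_div_lt (neg_pos.2 hi)
      exact mem_iUnion.2 ⟨n, mem_iUnion.2 ⟨i, by rw [mem_ofPred_eq]; linarith⟩⟩)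
    (directed_of_isDirected_le fun m n hmn => iUnion_mono fun i x hx =>
      lt_of_lt_of_le (show ℓ i x < _ from hx) (neg_le_neg (Nat.one_div_le_one_div hmn)))
  refine ⟨N + 1, by positivity, fun x M hx => ?_⟩
  by_cases hx0 : x = 0
  · exact Or.inr hx0
  left
  have hn : 0 < ‖x‖ := norm_pos_iff.2 hx0
  have := hN (show ‖x‖⁻¹ • x ∈ Metric.sphere (0 : E) 1 by
    simp [norm_smul, hn.ne'])
  obtain ⟨i, hi⟩ := mem_iUnion.1 this
  rw [mem_ofPred_eq, map_smul, smul_eq_mul, inv_mul_eq_div, div_lt_iff₀ hn] at hi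
  have h2 : 1 / ((N : ℝ) + 1) * ‖x‖ < M := by linarith [hx i]
  rw [one_div, inv_mul_eq_div, div_lt_iff₀ (by positivity)] at h2
  linarith

theorem TrivialRecession.isBounded_polyhedron [FiniteDimensional ℝ E] [Fintype ι] (hℓ : TrivialRecession ℓ) (M : ℝ) :
    ∃ B : Set E, IsCompact B ∧ ∀ b : ι → ℝ, ‖b‖ ≤ M → polyhedron ℓ b ⊆ B := by
  obtain ⟨C, hC, h⟩ := hℓ.exists_norm_le
  refine ⟨Metric.closedBall 0 (C * M), isCompact_closedBall _ _, fun b hb x hx => ?_⟩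
  have hM : 0 ≤ M := (norm_nonneg b).trans hb
  rw [mem_closedBall_zero_iff]
  have hxM : ∀ i, -M ≤ ℓ i x := fun i =>
    (abs_le.1 ((norm_le_pi_norm b i).trans hb)).1.trans (hx i)
  rcases h x M hxM with h | rfl
  · exact h
  · rw [norm_zero]; positivity

theorem TrivialRecession.facetFunctionals (hℓ : TrivialRecession ℓ) (j : ι) :
    TrivialRecession (facetFunctionals ℓ j) := by
  intro y hy
  ext
  refine hℓ y fun i => ?_
  by_cases hij : i = j
  · subst hij
    exact (LinearMap.mem_ker.1 y.2).ge
  · exact hy ⟨i, hij⟩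

theorem facetFunctionals_eq_zero {j : ι} {e : E} (he : ℓ j e = 1) {i : {i // i ≠ j}}
    (h : facetFunctionals ℓ j i = 0) : ℓ i = ℓ i e • ℓ j := by
  ext x
  have hx : x - ℓ j x • e ∈ LinearMap.ker (ℓ j).toLinearMap := by
    simp [he]
  have := DFunLike.congr_fun h ⟨_, hx⟩
  simp only [facetFunctionals, ContinuousLinearMap.comp_apply, Submodule.subtypeL_apply, map_sub,
    map_smul, smul_eq_mul, zero_apply] at this
  simp only [smul_apply, smul_eq_mul]
  linarith

/-- A relation among restrictions is a combination that vanishes on `ker (ℓ j)`, hence a multiple of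
`ℓ j`: a relation with one more functional. -/
theorem linearIndepOn_facetFunctionals {k : ℕ} {j : ι}
    (h : ∀ s : Finset ι, s.card ≤ k + 1 → LinearIndepOn ℝ ℓ s)
    {e : E} (he : ℓ j e = 1) (s : Finset {i // i ≠ j}) (hs : s.card ≤ k) :
    LinearIndepOn ℝ (facetFunctionals ℓ j) s := by
  classical
  rw [linearIndepOn_finset_iff]
  intro c hc
  set f : E →L[ℝ] ℝ := ∑ i ∈ s, c i • ℓ i with hf
  have hfx : ∀ x, f x = ∑ i ∈ s, c i * ℓ i x := by
    intro x
    simp [hf]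
  have hker : ∀ x, ℓ j x = 0 → f x = 0 := by
    intro x hx
    have := DFunLike.congr_fun hc ⟨x, LinearMap.mem_ker.2 hx⟩
    rw [hfx]
    simpa [facetFunctionals, sum_apply] using this
  have hfe : ∀ x, f x = f e * ℓ j x := by
    intro x
    have := hker (x - ℓ j x • e) (by simp [he])
    simp only [map_sub, map_smul, smul_eq_mul] at this
    linarith
  let S : Finset ι := insert j (s.map (Function.Embedding.subtype _))
  have hjS : j ∉ s.map (Function.Embedding.subtype _) := by simp
  have hS := h S (by rw [Finset.card_insert_of_notMem hjS, Finset.card_map]; omega)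
  rw [linearIndepOn_finset_iff] at hS
  obtain ⟨d, hdj, hdc⟩ : ∃ d : ι → ℝ, d j = -f e ∧ ∀ i : {i // i ≠ j}, d i = c i :=
    ⟨fun i => if h : i ≠ j then c ⟨i, h⟩ else -f e, by simp, fun i => dif_pos i.2⟩
  have := hS d (by
    rw [Finset.sum_insert hjS, Finset.sum_map, hdj]
    simp only [Function.Embedding.subtype_apply, hdc]
    ext x
    rw [← hf, add_apply, hfe x]
    simp)
  intro i hi
  rw [← hdc]
  exact this i (by simp [S, hi, i.2])

theorem continuous_facetBounds (ℓ : ι → E →L[ℝ] ℝ) (j : ι) (e : E) :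
    Continuous (facetBounds ℓ j e) := by
  unfold facetBounds
  fun_prop

theorem contDiff_facetBounds [Fintype ι] [DecidableEq ι] (ℓ : ι → E →L[ℝ] ℝ) (j : ι) (e : E)
    (n : WithTop ℕ∞) : ContDiff ℝ n (facetBounds ℓ j e) := by
  unfold facetBounds
  fun_prop

/-! ### Continuity of the volume and slicing -/

variable [FiniteDimensional ℝ E] [MeasurableSpace E] [BorelSpace E] (μ : Measure E) [μ.IsAddHaarMeasure]

theorem measure_level_set_eq_zero {f : E →L[ℝ] ℝ} {r : ℝ} (h : f ≠ 0 ∨ r ≠ 0) :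
    μ {x | f x = r} = 0 := by
  by_cases hf : f = 0
  · subst hf
    have hr := h.resolve_left (by simp)
    simp [hr.symm]
  by_cases hne : ∃ x, f x = r
  · obtain ⟨x, hx⟩ := hne
    have := Measure.addHaar_affineSubspace μ
      (AffineSubspace.mk' x (LinearMap.ker f.toLinearMap)) (by
        intro htop
        apply hf
        have h1 : (AffineSubspace.mk' x (LinearMap.ker f.toLinearMap)).direction = ⊤ := by
          rw [htop, AffineSubspace.direction_top]
        rw [AffineSubspace.direction_mk'] at h1
        ext y
        have : y ∈ LinearMap.ker f.toLinearMap := h1 ▸ Submodule.mem_top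
        simpa using this)
    refine measure_mono_null (fun y hy => ?_) this
    simp only [SetLike.mem_coe, AffineSubspace.mem_mk', vsub_eq_sub, LinearMap.mem_ker]
    have hy' : f y = r := hy
    simp [hy', hx]
  · push Not at hne
    simp [hne]

/-- Off the null sets `ℓ i x = b i` each inequality is stable under small changes of `b`, so the
indicators converge almost everywhere, inside a common compact set. -/
theorem continuousAt_measure_polyhedron [Fintype ι] (hℓ : TrivialRecession ℓ) {b : ι → ℝ}
    (hb : ∀ i, ℓ i ≠ 0 ∨ b i ≠ 0) : ContinuousAt (fun b => μ.real (polyhedron ℓ b)) b := by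
  obtain ⟨B, hB, hsub⟩ := hℓ.isBounded_polyhedron (‖b‖ + 1)
  have hev : ∀ᶠ c in 𝓝 b, ‖c‖ ≤ ‖b‖ + 1 :=
    continuous_norm.continuousAt.eventually (Iic_mem_nhds (by linarith))
  have hfin : μ (polyhedron ℓ b) ≠ ⊤ :=
    ((measure_mono (hsub b (by linarith))).trans_lt hB.measure_lt_top).ne
  refine (ENNReal.tendsto_toReal hfin).comp ?_
  refine tendsto_measure_of_ae_tendsto_indicator (𝓝 b) (isClosed_polyhedron ℓ b).measurableSet
    (fun c => (isClosed_polyhedron ℓ c).measurableSet) hB.measurableSet hB.measure_lt_top.ne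
    (hev.mono fun c hc => hsub c hc) ?_
  have hae : ∀ᵐ x ∂μ, ∀ i, ℓ i x ≠ b i :=
    ae_all_iff.2 fun i => measure_eq_zero_iff_ae_notMem.1 (measure_level_set_eq_zero μ (hb i))
  filter_upwards [hae] with x hx
  have : ∀ i, ∀ᶠ c in 𝓝 b, (c i ≤ ℓ i x ↔ b i ≤ ℓ i x) := by
    intro i
    have hci : Tendsto (fun c : ι → ℝ => c i) (𝓝 b) (𝓝 (b i)) := (continuous_apply i).tendsto b
    rcases (hx i).lt_or_gt with h | h
    · filter_upwards [hci.eventually (lt_mem_nhds h)] with c hc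
      exact iff_of_false hc.not_ge h.not_ge
    · filter_upwards [hci.eventually (gt_mem_nhds h)] with c hc
      exact iff_of_true hc.le h.le
  filter_upwards [eventually_all.2 this] with c hc
  exact forall_congr' hc

/-- In `E ≅ ℝ × ker f`, uniqueness of Haar measure makes `μ` a multiple of a product measure; `ν`
absorbs the factor. -/
theorem exists_facet_measure {f : E →L[ℝ] ℝ} (hf : f ≠ 0) :
    ∃ e : E, f e = 1 ∧ ∃ ν : Measure (LinearMap.ker f.toLinearMap), ν.IsAddHaarMeasure ∧
      ∀ s : Set E, MeasurableSet s →
        MeasurableSet {p : ℝ × LinearMap.ker f.toLinearMap | p.1 • e + p.2 ∈ s} ∧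
        μ s = (volume.prod ν) {p : ℝ × LinearMap.ker f.toLinearMap | p.1 • e + p.2 ∈ s} := by
  obtain ⟨x, hx⟩ : ∃ x, f x ≠ 0 := by
    by_contra! h
    exact hf (ContinuousLinearMap.ext h)
  set e : E := (f x)⁻¹ • x with he_def
  have he : f e = 1 := by simp [he_def, hx]
  let Φ : (ℝ × LinearMap.ker f.toLinearMap) ≃ₗ[ℝ] E :=
    { toFun := fun p => p.1 • e + p.2
      map_add' := fun p q => by simp [add_smul]; abel
      map_smul' := fun r p => by simp [mul_smul]
      invFun := fun y => (f y, ⟨y - f y • e, by simp [he]⟩)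
      left_inv := fun p => by
        have : f (p.2 : E) = 0 := LinearMap.mem_ker.1 p.2.2
        ext <;> simp [he, this]
      right_inv := fun y => by simp }
  let Ψ := Φ.toContinuousLinearEquiv
  let ν₀ : Measure (LinearMap.ker f.toLinearMap) := Measure.addHaar
  have h1 : (μ.map Ψ.symm).IsAddHaarMeasure := Ψ.symm.isAddHaarMeasure_map μ
  set c := Measure.addHaarScalarFactor (μ.map Ψ.symm) ((volume : Measure ℝ).prod ν₀) with hc
  have hc0 : 0 < c := Measure.addHaarScalarFactor_pos_of_isAddHaarMeasure _ _
  have h2 : μ.map Ψ.symm = c • ((volume : Measure ℝ).prod ν₀) :=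
    Measure.isAddLeftInvariant_eq_smul _ _
  refine ⟨e, he, (c : ENNReal) • ν₀, Measure.IsAddHaarMeasure.smul _
    (by exact_mod_cast hc0.ne') ENNReal.coe_ne_top, fun s hs => ?_⟩
  have hset : {p : ℝ × LinearMap.ker f.toLinearMap | p.1 • e + p.2 ∈ s} = Ψ ⁻¹' s := rfl
  have hmeas : MeasurableSet (Ψ ⁻¹' s) := Ψ.continuous.measurable hs
  rw [hset]
  refine ⟨hmeas, ?_⟩
  have h3 : (volume : Measure ℝ).prod ((c : ENNReal) • ν₀) = c • ((volume : Measure ℝ).prod ν₀) := by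
    rw [Measure.prod_smul_right]
    rfl
  rw [h3, ← h2, Measure.map_apply Ψ.symm.continuous.measurable hmeas]
  congr 1
  ext y
  simp

end

/-! ### Facet volumes as partial derivatives -/

section

variable {E : Type u} [NormedAddCommGroup E] [NormedSpace ℝ E] [FiniteDimensional ℝ E]
  [MeasurableSpace E] {ι : Type v} [Fintype ι] {ℓ : ι → E →L[ℝ] ℝ}
  (μ : Measure E) [μ.IsAddHaarMeasure]

theorem TrivialRecession.measure_polyhedron_ne_top (hℓ : TrivialRecession ℓ) (b : ι → ℝ) :
    μ (polyhedron ℓ b) ≠ ⊤ := by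
  obtain ⟨B, hB, hsub⟩ := hℓ.isBounded_polyhedron ‖b‖
  exact ((measure_mono (hsub b le_rfl)).trans_lt hB.measure_lt_top).ne

variable [BorelSpace E] [DecidableEq ι]

/-- The slice at level `s` does not depend on the bound `u`, which only restricts `s` to `Ici u`;
the fundamental theorem of calculus applies at the lower limit. -/
theorem exists_facet_hasDerivAt (hℓ : TrivialRecession ℓ) {j : ι} (hj : ℓ j ≠ 0) :
    ∃ e : E, ℓ j e = 1 ∧ ∃ ν : Measure (LinearMap.ker (ℓ j).toLinearMap), ν.IsAddHaarMeasure ∧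
      ∀ b : ι → ℝ, ContinuousAt
        (fun b => ν.real (polyhedron (facetFunctionals ℓ j) (facetBounds ℓ j e b))) b →
      HasDerivAt (fun u => μ.real (polyhedron ℓ (Function.update b j u)))
        (-ν.real (polyhedron (facetFunctionals ℓ j) (facetBounds ℓ j e b))) (b j) := by
  obtain ⟨e, he, ν, hν, hμ⟩ := exists_facet_measure μ hj
  refine ⟨e, he, ν, hν, fun b hb => ?_⟩
  set G : ℝ → ENNReal := fun s =>
    ν (polyhedron (facetFunctionals ℓ j) (facetBounds ℓ j e (Function.update b j s))) with hG
  have hGfin : ∀ s, G s ≠ ⊤ := fun s => (hℓ.facetFunctionals j).measure_polyhedron_ne_top ν _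
  let T : Set (ℝ × LinearMap.ker (ℓ j).toLinearMap) :=
    ⋂ i : {i // i ≠ j}, {p | b i ≤ ℓ i (p.1 • e + p.2)}
  have hT : IsClosed T := isClosed_iInter fun i => isClosed_le continuous_const (by fun_prop)
  have hmem : ∀ s y, y ∈ polyhedron (facetFunctionals ℓ j)
      (facetBounds ℓ j e (Function.update b j s)) ↔
        ∀ i : {i // i ≠ j}, b i ≤ ℓ i (s • e + (y : E)) := by
    intro s y
    refine forall_congr' fun i => ?_
    simp only [facetBounds, facetFunctionals, Function.update_self,
      Function.update_of_ne i.2, ContinuousLinearMap.comp_apply, Submodule.subtypeL_apply,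
      map_add, map_smul, smul_eq_mul]
    constructor <;> intro h <;> linarith
  have hGm : Measurable G := by
    have := measurable_measure_prodMk_left (ν := ν) hT.measurableSet
    convert! this using 3 with s
    ext y
    simp only [hmem, T, mem_preimage, mem_iInter, mem_ofPred_eq]
  have hslice : ∀ u, μ (polyhedron ℓ (Function.update b j u)) = ∫⁻ s in Ici u, G s := by
    intro u
    obtain ⟨h1, h2⟩ := hμ _ (isClosed_polyhedron ℓ (Function.update b j u)).measurableSet
    rw [h2, Measure.prod_apply h1, ← lintegral_indicator measurableSet_Ici]
    refine lintegral_congr fun s => ?_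
    have hjs : ∀ y : LinearMap.ker (ℓ j).toLinearMap, ℓ j (s • e + y) = s := by
      intro y
      have : ℓ j (y : E) = 0 := LinearMap.mem_ker.1 y.2
      simp [he, this]
    by_cases hs : u ≤ s
    · rw [indicator_of_mem (show s ∈ Ici u from hs)]
      simp only [hG]
      congr 1
      ext y
      rw [hmem]
      simp only [mem_preimage, mem_ofPred_eq, polyhedron]
      constructor
      · intro h i
        simpa [i.2] using h i
      · intro h i
        by_cases hij : i = j
        · subst hij
          rw [hjs, Function.update_self]
          exact hs
        · rw [Function.update_of_ne hij]
          exact h ⟨i, hij⟩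
    · rw [indicator_of_notMem (show s ∉ Ici u from hs)]
      convert measure_empty (μ := ν)
      refine eq_empty_of_forall_notMem fun y hy => hs ?_
      have := hy j
      rwa [Function.update_self, hjs] at this
  set φ : ℝ → ℝ := fun s => (G s).toReal with hφ
  have hint : ∀ u, IntegrableOn φ (Ici u) := fun u =>
    integrable_toReal_of_lintegral_ne_top hGm.aemeasurable
      (by rw [← hslice]; exact hℓ.measure_polyhedron_ne_top μ _)
  have hV : ∀ u, μ.real (polyhedron ℓ (Function.update b j u)) = ∫ s in Ici u, φ s := by
    intro u
    rw [measureReal_def, hslice, integral_toReal hGm.aemeasurable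
      (Eventually.of_forall fun s => (hGfin s).lt_top)]
  have hV2 : ∀ u, μ.real (polyhedron ℓ (Function.update b j u)) =
      (∫ s in Ici (b j), φ s) - ∫ s in (b j)..u, φ s := by
    intro u
    rw [hV, ← intervalIntegral.integral_Ici_sub_Ici' (hint _) (hint _)]
    ring
  have hcont : ContinuousAt φ (b j) := by
    have hu : ContinuousAt (fun s => Function.update b j s) (b j) := by fun_prop
    have hb' : ContinuousAt (fun b => ν.real (polyhedron (facetFunctionals ℓ j)
        (facetBounds ℓ j e b))) (Function.update b j (b j)) := by
      rwa [Function.update_eq_self]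
    exact hb'.comp (f := fun s => Function.update b j s) hu
  have hmeas : StronglyMeasurableAtFilter φ (𝓝 (b j)) :=
    hGm.ennreal_toReal.stronglyMeasurable.stronglyMeasurableAtFilter
  have hder := intervalIntegral.integral_hasDerivAt_right (a := b j)
    (IntervalIntegrable.refl) hmeas hcont
  have hφb : φ (b j) =
      ν.real (polyhedron (facetFunctionals ℓ j) (facetBounds ℓ j e b)) := by
    simp only [hφ, hG, Function.update_eq_self, measureReal_def]
  rw [← hφb]
  simp only [hV2]
  exact hder.const_sub _

/-- The volume of a polyhedron is differentiable in the bounds wherever no two parallel functionals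
give the same hyperplane; the partial derivatives are volumes of facets. -/
theorem exists_facets_hasFDerivAt (hℓ : TrivialRecession ℓ) (h0 : ∀ i, ℓ i ≠ 0) :
    ∃ e : ι → E, (∀ j, ℓ j (e j) = 1) ∧
      ∃ ν : ∀ j, Measure (LinearMap.ker (ℓ j).toLinearMap), (∀ j, (ν j).IsAddHaarMeasure) ∧
      ∀ b : ι → ℝ, (∀ i j, i ≠ j → ∀ c : ℝ, ℓ i = c • ℓ j → b i ≠ c * b j) →
        HasFDerivAt (fun b => μ.real (polyhedron ℓ b))
          (∑ j, (-(ν j).real (polyhedron (facetFunctionals ℓ j) (facetBounds ℓ j (e j) b))) •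
            ContinuousLinearMap.proj (R := ℝ) (φ := fun _ : ι => ℝ) j) b := by
  choose e he ν hν hder using fun j => exists_facet_hasDerivAt μ hℓ (h0 j)
  refine ⟨e, he, ν, hν, fun b hb => ?_⟩
  have hcont : ∀ j, ∀ x : ι → ℝ,
      (∀ i : {i // i ≠ j}, facetFunctionals ℓ j i ≠ 0 ∨ facetBounds ℓ j (e j) x i ≠ 0) →
      ContinuousAt (fun b => (ν j).real
        (polyhedron (facetFunctionals ℓ j) (facetBounds ℓ j (e j) b))) x := fun j x hx =>
    (continuousAt_measure_polyhedron (ν j) (hℓ.facetFunctionals j) hx).comp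
      (f := facetBounds ℓ j (e j)) (continuous_facetBounds ℓ j (e j)).continuousAt
  have hgen : ∀ j, ∀ i : {i // i ≠ j},
      facetFunctionals ℓ j i ≠ 0 ∨ facetBounds ℓ j (e j) b i ≠ 0 := by
    intro j i
    by_cases h : facetFunctionals ℓ j i = 0
    · right
      have := hb i j i.2 _ (facetFunctionals_eq_zero (he j) h)
      simp only [facetBounds]
      intro h'
      exact this (by linarith)
    · exact Or.inl h
  refine hasFDerivAt_of_continuousAt_partials
    (g := fun j b => -(ν j).real (polyhedron (facetFunctionals ℓ j) (facetBounds ℓ j (e j) b)))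
    (fun j => ?_) fun j => (hcont j b (hgen j)).neg
  -- Genericity is an open condition, so the partial derivatives exist near `b`, not only at it.
  have hev : ∀ᶠ x in 𝓝 b, ∀ i : {i // i ≠ j},
      facetFunctionals ℓ j i ≠ 0 ∨ facetBounds ℓ j (e j) x i ≠ 0 := by
    rw [eventually_all]
    intro i
    rcases hgen j i with h | h
    · exact Eventually.of_forall fun _ => Or.inl h
    · have hc : Continuous fun x => facetBounds ℓ j (e j) x i :=
        (continuous_apply i).comp (continuous_facetBounds ℓ j (e j))
      exact (hc.continuousAt.eventually_ne h).mono fun _ => Or.inr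
  filter_upwards [hev] with x hx
  exact hder j x (hcont j x hx)

end

/-! ### Smoothness in the bounds -/

/-- If any `k + 1` of the functionals are linearly independent, then the volume of the polyhedron
is a function of class `C^k` of the bounds. -/
theorem contDiff_measure_polyhedron (k : ℕ) : ∀ {E : Type u} [NormedAddCommGroup E]
    [NormedSpace ℝ E] [FiniteDimensional ℝ E] [MeasurableSpace E] [BorelSpace E] {ι : Type v}
    [Fintype ι] {ℓ : ι → E →L[ℝ] ℝ} (μ : Measure E) [μ.IsAddHaarMeasure],
    TrivialRecession ℓ → (∀ s : Finset ι, s.card ≤ k + 1 → LinearIndepOn ℝ ℓ s) →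
    ContDiff ℝ k fun b : ι → ℝ => μ.real (polyhedron ℓ b) := by
  induction k with
  | zero =>
    intro E _ _ _ _ _ ι _ ℓ μ _ hℓ hind
    have h0 : ∀ i, ℓ i ≠ 0 := fun i =>
      (hind {i} (by simp)).ne_zero (by simp)
    rw [Nat.cast_zero, contDiff_zero, continuous_iff_continuousAt]
    exact fun b => continuousAt_measure_polyhedron μ hℓ fun i => Or.inl (h0 i)
  | succ k ih =>
    intro E _ _ _ _ _ ι _ ℓ μ _ hℓ hind
    classical
    have h0 : ∀ i, ℓ i ≠ 0 := fun i =>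
      (hind {i} (by simp)).ne_zero (by simp)
    obtain ⟨e, he, ν, hν, hder⟩ := exists_facets_hasFDerivAt μ hℓ h0
    rw [Nat.cast_succ, contDiff_succ_iff_hasFDerivAt]
    refine ⟨_, ?_, fun b => hder b fun i j hij c hc => ?_⟩
    · refine ContDiff.sum fun j _ => ?_
      have h := (ih (ν j) (hℓ.facetFunctionals j) fun s hs =>
        linearIndepOn_facetFunctionals hind (he j) s hs).comp (contDiff_facetBounds ℓ j (e j) _)
      exact h.neg.smul contDiff_const
    -- Any two functionals are independent here, so none are parallel.
    · exfalso
      have h2 := hind {i, j} (by rw [Finset.card_pair hij]; omega)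
      rw [linearIndepOn_finset_iff] at h2
      have := h2 (fun l => if l = i then 1 else -c) (by
        rw [Finset.sum_pair hij]
        simp [hij.symm, hc]) i (by simp)
      simp at this

/-! ### Piecewise polynomiality in time -/

theorem facetBounds_add_smul {E : Type u} [NormedAddCommGroup E] [NormedSpace ℝ E] {ι : Type v}
    (ℓ : ι → E →L[ℝ] ℝ) (j : ι) (e : E) (p v : ι → ℝ) (t : ℝ) :
    facetBounds ℓ j e (p + t • v) = facetBounds ℓ j e p + t • facetBounds ℓ j e v := by
  ext i
  simp only [facetBounds, Pi.add_apply, Pi.smul_apply, smul_eq_mul]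
  ring

/-- For piecewise polynomiality one may assume that all functionals are nonzero and that no two of
them define the same hyperplane at all times. -/
theorem isPiecewisePolynomial_measure_polyhedron_of_generic (n : ℕ)
    {E : Type u} [NormedAddCommGroup E] [NormedSpace ℝ E] [FiniteDimensional ℝ E]
    [MeasurableSpace E] [BorelSpace E] (μ : Measure E) [μ.IsAddHaarMeasure]
    (hgen : ∀ {ι : Type v} [Fintype ι] {ℓ : ι → E →L[ℝ] ℝ}, TrivialRecession ℓ →
      (∀ i, ℓ i ≠ 0) → ∀ p v : ι → ℝ,
      (∀ i j, i ≠ j → ∀ c : ℝ, ℓ i = c • ℓ j → p i = c * p j → v i ≠ c * v j) →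
      IsPiecewisePolynomial n fun t => μ.real (polyhedron ℓ (p + t • v))) (m : ℕ) :
    ∀ {ι : Type v} [Fintype ι] {ℓ : ι → E →L[ℝ] ℝ}, Fintype.card ι = m → TrivialRecession ℓ →
      ∀ p v : ι → ℝ, IsPiecewisePolynomial n fun t => μ.real (polyhedron ℓ (p + t • v)) := by
  induction m with
  | zero =>
    intro ι _ ℓ hm hℓ p v
    have := Fintype.card_eq_zero_iff.1 hm
    exact hgen hℓ (fun i => isEmptyElim i) p v fun i => isEmptyElim i
  | succ m ih =>
    intro ι _ ℓ hm hℓ p v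
    classical
    have hcard : ∀ i : ι, Fintype.card {x // x ≠ i} = m := fun i => by
      rw [Fintype.card_subtype_compl, Fintype.card_subtype_eq, hm, Nat.add_sub_cancel]
    by_cases h0 : ∃ i, ℓ i = 0
    · obtain ⟨i, hi⟩ := h0
      -- A zero functional imposes a condition on `t` alone: it is either vacuous or empties the
      -- polyhedron.
      have hℓ' : TrivialRecession fun x : {x // x ≠ i} => ℓ x := fun x hx => hℓ x fun l => by
        by_cases hl : l = i
        · simp [hl, hi]
        · exact hx ⟨l, hl⟩
      have := (ih (hcard i) hℓ' (fun x => p x) (fun x => v x)).ite_affine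
        (IsPiecewisePolynomial.const n 0) (-p i) (-v i)
      convert! this using 2 with t
      split_ifs with h
      · congr 1
        ext x
        refine ⟨fun hx l => hx l, fun hx l => ?_⟩
        by_cases hl : l = i
        · subst hl
          simp only [hi, Pi.add_apply, Pi.smul_apply, smul_eq_mul, zero_apply]
          linarith
        · exact hx ⟨l, hl⟩
      · convert measureReal_empty (μ := μ)
        refine eq_empty_of_forall_notMem fun x hx => h ?_
        have := hx i
        simp only [hi, Pi.add_apply, Pi.smul_apply, smul_eq_mul, zero_apply] at this
        linarith
    push Not at h0
    by_cases hpar : ∃ i j, i ≠ j ∧ ∃ c : ℝ, ℓ i = c • ℓ j ∧ p i = c * p j ∧ v i = c * v j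
    · obtain ⟨i, j, hij, c, hc, hp, hv⟩ := hpar
      have hbi : ∀ t : ℝ, (p + t • v) i = c * (p + t • v) j := fun t => by
        simp only [Pi.add_apply, Pi.smul_apply, smul_eq_mul, hp, hv]
        ring
      have hli : ∀ x, ℓ i x = c * ℓ j x := fun x => by simp [hc]
      have hc0 : c ≠ 0 := by
        rintro rfl
        exact h0 i (by simpa using hc)
      -- For `c < 0` the two inequalities confine the polyhedron to a hyperplane; for `c > 0` one of
      -- them is redundant.
      rcases hc0.lt_or_gt with hneg | hpos
      · convert! IsPiecewisePolynomial.const n 0 using 2 with t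
        rw [measureReal_def, ENNReal.toReal_eq_zero_iff]
        left
        refine measure_mono_null (fun x hx => ?_)
          (measure_level_set_eq_zero μ (f := ℓ j) (r := (p + t • v) j) (Or.inl (h0 j)))
        have h1 := hx i
        rw [hbi, hli] at h1
        exact le_antisymm ((mul_le_mul_left_of_neg hneg).1 h1) (hx j)
      · have hℓ' : TrivialRecession fun x : {x // x ≠ i} => ℓ x := fun x hx => hℓ x fun l => by
          by_cases hl : l = i
          · rw [hl, hli]
            exact mul_nonneg hpos.le (hx ⟨j, hij.symm⟩)
          · exact hx ⟨l, hl⟩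
        convert! ih (hcard i) hℓ' (fun x => p x) (fun x => v x) using 3 with t
        ext x
        refine ⟨fun hx l => hx l, fun hx l => ?_⟩
        by_cases hl : l = i
        · rw [hl, hbi, hli]
          exact mul_le_mul_of_nonneg_left (hx ⟨j, hij.symm⟩) hpos.le
        · exact hx ⟨l, hl⟩
    · push Not at hpar
      exact hgen hℓ h0 p v hpar

/-- The volume of a polyhedron whose facets move at constant speeds is a piecewise polynomial
function of time, of degree at most the dimension of the space. -/
theorem isPiecewisePolynomial_measure_polyhedron (n : ℕ) : ∀ {E : Type u} [NormedAddCommGroup E]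
    [NormedSpace ℝ E] [FiniteDimensional ℝ E] [MeasurableSpace E] [BorelSpace E]
    (μ : Measure E) [μ.IsAddHaarMeasure] {ι : Type v} [Fintype ι] {ℓ : ι → E →L[ℝ] ℝ},
    Module.finrank ℝ E = n → TrivialRecession ℓ → ∀ p v : ι → ℝ,
    IsPiecewisePolynomial n fun t => μ.real (polyhedron ℓ (p + t • v)) := by
  induction n with
  | zero =>
    intro E _ _ _ _ _ μ _ ι _ ℓ hn hℓ p v
    refine isPiecewisePolynomial_measure_polyhedron_of_generic 0 μ ?_ _ rfl hℓ p v
    intro ι _ ℓ hℓ h0 p v _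
    have := Module.finrank_zero_iff.1 hn
    have : IsEmpty ι := ⟨fun i => h0 i (by ext x; simp [Subsingleton.elim x 0])⟩
    convert! IsPiecewisePolynomial.const 0 (μ.real (polyhedron ℓ p)) using 4 with t
  | succ n ih =>
    intro E _ _ _ _ _ μ _ ι _ ℓ hn hℓ p v
    refine isPiecewisePolynomial_measure_polyhedron_of_generic (n + 1) μ ?_ _ rfl hℓ p v
    intro ι _ ℓ hℓ h0 p v hpar
    classical
    obtain ⟨e, he, ν, hν, hder⟩ := exists_facets_hasFDerivAt μ hℓ h0
    -- Times at which two hyperplanes coincide: two such times for one pair would make them coincide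
    -- always, against `hpar`.
    let bad : ι → ι → Set ℝ := fun i j =>
      {t | i ≠ j ∧ ∃ c : ℝ, ℓ i = c • ℓ j ∧ (p + t • v) i = c * (p + t • v) j}
    have hbad : (⋃ i, ⋃ j, bad i j).Finite := by
      refine finite_iUnion fun i => finite_iUnion fun j => Set.Subsingleton.finite ?_
      rintro t ⟨hij, c, hc, ht⟩ t' ⟨-, c', hc', ht'⟩
      have hcc : c' = c := smul_left_injective ℝ (h0 j) (hc'.symm.trans hc)
      subst hcc
      by_contra hne
      simp only [Pi.add_apply, Pi.smul_apply, smul_eq_mul] at ht ht'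
      have hv : v i = c' * v j := by
        refine mul_left_cancel₀ (sub_ne_zero.2 hne) ?_
        linear_combination ht - ht'
      refine hpar i j hij c' hc ?_ hv
      rw [hv] at ht
      linear_combination ht
    refine IsPiecewisePolynomial.of_hasDerivAt (f' := fun t => ∑ j, -v j *
      (ν j).real (polyhedron (facetFunctionals ℓ j) (facetBounds ℓ j (e j) p +
        t • facetBounds ℓ j (e j) v))) hbad.toFinset (fun t ht => ?_) ?_
    · have hline : HasDerivAt (fun t : ℝ => p + t • v) v t := by
        simpa using ((hasDerivAt_id t).smul_const v).const_add p
      have hgood : ∀ i j, i ≠ j → ∀ c : ℝ, ℓ i = c • ℓ j →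
          (p + t • v) i ≠ c * (p + t • v) j := by
        intro i j hij c hc heq
        rw [Set.Finite.mem_toFinset] at ht
        exact ht (mem_iUnion.2 ⟨i, mem_iUnion.2 ⟨j, hij, c, hc, heq⟩⟩)
      convert! (hder _ hgood).comp_hasDerivAt t hline using 1
      rw [sum_apply]
      refine Finset.sum_congr rfl fun j _ => ?_
      simp only [facetBounds_add_smul, smul_apply, ContinuousLinearMap.proj_apply, smul_eq_mul]
      ring
    · refine IsPiecewisePolynomial.sum _ fun j _ => IsPiecewisePolynomial.const_mul _ ?_
      refine ih (ν j) ?_ (hℓ.facetFunctionals j) _ _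
      have := Module.Dual.finrank_ker_add_one_of_ne_zero (f := (ℓ j).toLinearMap) (by
        intro h
        exact h0 j (ContinuousLinearMap.coe_injective h))
      omega

/-! ### Gliding arrangements -/

theorem HasAbsoluteRank.linearIndepOn {d m k : ℕ} {N : Fin m → EuclideanSpace ℝ (Fin d)}
    (h : _root_.HasAbsoluteRank N k) (s : Finset (Fin m)) (hs : s.card ≤ k) :
    LinearIndepOn ℝ N s := by
  -- For `k > m` the independence clause would be vacuous; the second clause rules this out.
  have hkm : k ≤ m := by
    rcases h.2 with ⟨s, hs, -⟩ | ⟨rfl, rfl⟩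
    · have := s.card_le_univ
      rw [Fintype.card_fin] at this
      omega
    · exact le_rfl
  obtain ⟨T, hsT, hT⟩ := Finset.exists_superset_card_eq hs (by rwa [Fintype.card_fin])
  exact LinearIndepOn.mono (h.1 T hT) (by exact_mod_cast hsT)

namespace GlidingArrangement

variable {d m : ℕ}

/-- The functionals whose lower bounds define the cell. -/
noncomputable def functional (A : GlidingArrangement d m) (ε : Fin m → ℤˣ) (j : Fin m) :
    EuclideanSpace ℝ (Fin d) →L[ℝ] ℝ :=
  ((ε j : ℤ) : ℝ) • innerSL ℝ (A j).normal

theorem cell_eq_polyhedron (A : GlidingArrangement d m) (ε : Fin m → ℤˣ) (t : ℝ) :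
    A.cell ε t = polyhedron (A.functional ε)
      ((fun j => A.functional ε j (A j).point) + t • fun j => A.functional ε j (A j).velocity) := by
  ext Q
  refine forall_congr' fun j => ?_
  simp only [GlidingHyperplane.atTime, OrientedHyperplane.signedDist, functional, Pi.add_apply,
    Pi.smul_apply, smul_eq_mul, smul_apply, innerSL_apply_apply,
    real_inner_comm (A j).normal, inner_sub_right, inner_add_right, real_inner_smul_right]
  constructor <;> intro h <;> linarith

theorem linearIndepOn_functional {A : GlidingArrangement d m} (ε : Fin m → ℤˣ)
    {s : Finset (Fin m)} (h : LinearIndepOn ℝ (fun j => (A j).normal) s) :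
    LinearIndepOn ℝ (A.functional ε) s := by
  rw [linearIndepOn_finset_iff] at h ⊢
  intro c hc i hi
  have := h (fun j => c j * ((ε j : ℤ) : ℝ)) (by
    refine ext_inner_right ℝ fun x => ?_
    have := DFunLike.congr_fun hc x
    simpa [sum_inner, functional, real_inner_smul_left, mul_assoc] using this) i hi
  have hε : ((ε i : ℤ) : ℝ) ≠ 0 := by exact_mod_cast (ε i).ne_zero
  exact (mul_eq_zero.1 this).resolve_right hε

end GlidingArrangement

theorem mainTheorem2 {d m k : ℕ} (hd : 1 ≤ d) (A : GlidingArrangement d m)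
    (hA : A.IsFirstType) (hk : A.HasAbsoluteRank k)
    (ε : Fin m → ℤˣ) (t₀ : ℝ) (hbdd : Bornology.IsBounded (A.cell ε t₀))
    (hvol : MeasureTheory.volume (A.cell ε t₀) ≠ 0) :
    (∀ t, Bornology.IsBounded (A.cell ε t)) ∧
      IsPluriphaseSteinerLike d (A.cellVolume ε) ∧
      ContDiff ℝ ((k - 1 : ℕ) : WithTop ℕ∞) (A.cellVolume ε) := by
  have hne : (A.cell ε t₀).Nonempty := nonempty_of_measure_ne_zero hvol
  rw [A.cell_eq_polyhedron] at hbdd hne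
  have hℓ : TrivialRecession (A.functional ε) := .of_isBounded hbdd hne
  have hW : A.cellVolume ε = fun t => volume.real (polyhedron (A.functional ε)
      ((fun j => A.functional ε j (A j).point) +
        t • fun j => A.functional ε j (A j).velocity)) := by
    ext t
    rw [GlidingArrangement.cellVolume, A.cell_eq_polyhedron, measureReal_def]
  have hind : ∀ s : Finset (Fin m), s.card ≤ k - 1 + 1 →
      LinearIndepOn ℝ (A.functional ε) s := by
    intro s hs
    refine GlidingArrangement.linearIndepOn_functional ε ?_
    -- With truncated subtraction `k = 0` still asks for single functionals, settled by the normals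
    -- being unit vectors.
    rcases Nat.eq_zero_or_pos k with rfl | hk0
    · have h1 : ∀ i, (A i).normal ≠ 0 := fun i => by
        rw [← norm_ne_zero_iff, (A i).norm_normal]
        exact one_ne_zero
      rcases s.eq_empty_or_nonempty with rfl | ⟨i, hi⟩
      · simp
      · have : s = {i} := Finset.eq_singleton_iff_unique_mem.2
          ⟨hi, fun j hj => Finset.card_le_one.1 hs j hj i hi⟩
        rw [this, Finset.coe_singleton]
        exact .singleton (h1 i)
    · exact HasAbsoluteRank.linearIndepOn hk s (by omega)
  have hsmooth : ContDiff ℝ ((k - 1 : ℕ) : WithTop ℕ∞) (A.cellVolume ε) := by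
    rw [hW]
    exact (contDiff_measure_polyhedron (k - 1) volume hℓ hind).comp
      (contDiff_const.add (contDiff_id.smul contDiff_const))
  refine ⟨fun t => ?_, ?_, hsmooth⟩
  · rw [A.cell_eq_polyhedron]
    obtain ⟨B, hB, hsub⟩ := hℓ.isBounded_polyhedron _
    exact hB.isBounded.subset (hsub _ le_rfl)
  · refine IsPiecewisePolynomial.isPluriphaseSteinerLike ?_ hsmooth.continuous
      fun t => ENNReal.toReal_nonneg
    rw [hW]
    exact isPiecewisePolynomial_measure_polyhedron d volume (by simp) hℓ _ _
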